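/- Let $\kappa$ be a cardinal and assume $MA_\kappa$: for every nonempty c.c.c. notion of forcing $\mathbb P$ and every family $\mathcal D$ of at most $\kappa$ dense subsets of $\mathbb P$ there is a filter in $\mathbb P$ that meets every member of $\mathcal D$. Let $S=\mathrm{Sym}(\omega)$ be the group of all permutations of the natural numbers. (1) Suppose that for each $\alpha<\kappa$ we are given an ordinal $\theta_\alpha$ and an increasing chain $(H^\alpha_i)_{i<\theta_\alpha}$ of proper subgroups of $S$ (that is, $H^\alpha_i\subseteq H^\alpha_j$ whenever $i\le j<\theta_\alpha$) such that $S=\bigcup_{i<\theta_\alpha}H^\alpha_i$. Then for every $f\in\prod_{\alpha<\kappa}\theta_\alpha$, $$S\neq\bigcup_{\alpha<\kappa}H^\alpha_{f(\alpha)}.$$ (2) In particular $c(S)>\kappa$, where $c(S)$ is the least element of the cofinality spectrum $CF(S)$, the set of regular infinite cardinals $\lambda$ such that $S$ is the union of an increasing chain $(H_i)_{i<\lambda}$ of proper subgroups. -/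

import Mathlib

open Cardinal

universe u v

/-- Two conditions of a notion of forcing are compatible if they have a common strengthening
(`r ≤ p` means that `r` strengthens `p`). -/
def ForcingCompatible {P : Type u} [Preorder P] (p q : P) : Prop :=
  ∃ r : P, r ≤ p ∧ r ≤ q

/-- The countable chain condition: every set of pairwise incompatible conditions is countable. -/
def CountableChainCondition (P : Type u) [Preorder P] : Prop :=
  ∀ A : Set P, A.Pairwise (fun p q => ¬ ForcingCompatible p q) → A.Countable

/-- `MA_κ`: for every nonempty c.c.c. notion of forcing `P` and every family of at most `κ`
dense subsets of `P`, some filter in `P` (nonempty, upward closed, downward directed) meets every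
member of the family. A set `D` of conditions is dense if it is coinitial: every condition has a
strengthening in `D`. -/
def MartinsAxiom (κ : Cardinal.{u}) : Prop :=
  ∀ (P : Type u) [Preorder P] [Nonempty P], CountableChainCondition P →
    ∀ 𝒟 : Set (Set P), #𝒟 ≤ κ → (∀ D ∈ 𝒟, IsCoinitial D) →
      ∃ F : Order.PFilter P, ∀ D ∈ 𝒟, ((F : Set P) ∩ D).Nonempty

/-- `(H i : i ∈ I)` is an increasing chain of proper subgroups whose union is the whole group. -/
structure IsProperSubgroupChain {G : Type u} [Group G] {I : Type v} [LinearOrder I]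
    (H : I → Subgroup G) : Prop where
  mono : Monotone H
  proper : ∀ i, H i ≠ ⊤
  iUnion_eq : ⋃ i, (H i : Set G) = Set.univ

/-- The cofinality spectrum of `G`: the regular (infinite) cardinals `μ` such that `G` is the union
of a chain of proper subgroups indexed by `μ`. -/
def cofinalitySpectrum (G : Type u) [Group G] : Set Cardinal.{u} :=
  {μ | μ.IsRegular ∧ ∃ H : μ.ord.ToType → Subgroup G, IsProperSubgroupChain H}

/-- The cofinality `c(G)`: the least element of the cofinality spectrum. If the spectrum were empty
this would be `0`, so that `κ < groupCofinality G` also says that the spectrum is nonempty. -/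
noncomputable def groupCofinality (G : Type u) [Group G] : Cardinal.{u} :=
  sInf (cofinalitySpectrum G)

/-! Identify ω with `ℤ × C × ℤ`, `C` countable, viewed as the states of a machine with three
registers. There is a finite set F of permutations such that a subgroup containing F is everything
once, for each t : ℤ → ℤ, it has an element computing t, i.e. sending (n, c₀, 0) to (n, c₀, t n) for
all n (`Registers.exists_finite_eq_top_of_computes`).

κ may be taken infinite, and then MA_κ gives κ < 2^ℵ₀, so there are independent functions y_i : C →
ℤ for i < κ. A proper subgroup K_i containing F and the shear by y_i fails to compute some t_i. By
independence, MA_κ yields a single ψ with y_i (ψ n) = t_i n for almost all n, for every i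
(`MartinsAxiom.exists_eventually`). Were loading ψ n into the `C`-register an element of K_i, then
load, add y_i, unload would compute t_i up to finitely many n, and finite corrections also lie in
K_i if F is chosen suitably. So this one permutation avoids every K_i.

In a chain, F and the shear appear at some stage, so raising f(α) gives (1). For (2), use c(S)
copies of one chain of length c(S), with f the identity. -/

/-! ### Consequences of Martin's axiom -/

/-- Conditions for a generic sequence in `C`: a finite stem of the sequence, together with finitely
many indices `i : I` whose constraint `A i n` is to be respected by the later entries. -/
def StemForcing {I C : Type u} (_A : I → ℕ → C → Prop) : Type u :=
  List C × Finset I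

namespace StemForcing

variable {I C : Type u} {A : I → ℕ → C → Prop}

instance : Preorder (StemForcing A) where
  le q p := p.1 <+: q.1 ∧ p.2 ⊆ q.2 ∧
    ∀ i ∈ p.2, ∀ n c, p.1.length ≤ n → q.1[n]? = some c → A i n c
  le_refl p := by
    refine ⟨List.prefix_rfl, subset_rfl, fun i _ n c hn hc => ?_⟩
    rw [List.getElem?_eq_none hn] at hc
    cases hc
  le_trans r q p hrq hqp := by
    refine ⟨hqp.1.trans hrq.1, hqp.2.1.trans hrq.2.1, fun i hi n c hn hc => ?_⟩
    rcases lt_or_ge n q.1.length with hnq | hnq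
    · refine hqp.2.2 i hi n c hn ?_
      obtain ⟨l, hl⟩ := hrq.1
      rw [← hl, List.getElem?_append_left hnq] at hc
      exact hc
    · exact hrq.2.2 i (hqp.2.1 hi) n c hnq hc

theorem le_def {p q : StemForcing A} : q ≤ p ↔ p.1 <+: q.1 ∧ p.2 ⊆ q.2 ∧
    ∀ i ∈ p.2, ∀ n c, p.1.length ≤ n → q.1[n]? = some c → A i n c := Iff.rfl

instance : Nonempty (StemForcing A) := ⟨([], ∅)⟩

theorem le_of_stem_eq {p q : StemForcing A} (h : p.1 = q.1) (hpq : p.2 ⊆ q.2) : q ≤ p := by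
  refine ⟨h ▸ List.prefix_rfl, hpq, fun i _ n c hn hc => ?_⟩
  rw [← h, List.getElem?_eq_none hn] at hc
  cases hc

/-- Conditions with equal stems are compatible, and there are only countably many stems. -/
theorem countableChainCondition [Countable C] : CountableChainCondition (StemForcing A) := by
  classical
  intro S hS
  refine Set.MapsTo.countable_of_injOn (f := fun p : StemForcing A => p.1) (Set.mapsTo_univ _ _)
    (fun p hp q hq hpq => ?_) Set.countable_univ
  by_contra hne
  exact hS hp hq hne ⟨(p.1, p.2 ∪ q.2), le_of_stem_eq rfl Finset.subset_union_left,
    le_of_stem_eq (Eq.symm hpq) Finset.subset_union_right⟩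

theorem exists_le_lt_length (hA : ∀ (F : Finset I) n, ∃ c, ∀ i ∈ F, A i n c)
    (p : StemForcing A) (n : ℕ) : ∃ q ≤ p, n < q.1.length := by
  induction n generalizing p with
  | zero =>
    obtain ⟨c, hc⟩ := hA p.2 p.1.length
    refine ⟨(p.1 ++ [c], p.2), ⟨List.prefix_append _ _, subset_rfl, fun i hi n d hn hd => ?_⟩,
      by simp⟩
    have hlt := (List.getElem?_eq_some_iff.1 hd).1
    simp only [List.length_append, List.length_singleton] at hlt
    obtain rfl : n = p.1.length := by omega
    have : c = d := by simpa using hd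
    exact this ▸ hc i hi
  | succ n ih =>
    obtain ⟨q, hq, hn⟩ := ih p
    obtain ⟨c, hc⟩ := hA q.2 q.1.length
    refine ⟨(q.1 ++ [c], q.2), le_trans ?_ hq, by simp; omega⟩
    refine ⟨List.prefix_append _ _, subset_rfl, fun i hi n d hn hd => ?_⟩
    have hlt := (List.getElem?_eq_some_iff.1 hd).1
    simp only [List.length_append, List.length_singleton] at hlt
    obtain rfl : n = q.1.length := by omega
    have : c = d := by simpa using hd
    exact this ▸ hc i hi

end StemForcing

/-- Under `MA_κ`, `κ` many constraints on sequences, any finitely many of which can be met at each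
place, are met simultaneously up to finitely many places each. -/
theorem MartinsAxiom.exists_eventually {κ : Cardinal.{u}} (hMA : MartinsAxiom κ) (hκ : ℵ₀ ≤ κ)
    {I C : Type u} (hI : #I ≤ κ) [Countable C] {A : I → ℕ → C → Prop}
    (hA : ∀ (F : Finset I) n, ∃ c, ∀ i ∈ F, A i n c) :
    ∃ ψ : ℕ → C, ∀ i, ∀ᶠ n in Filter.atTop, A i n (ψ n) := by
  classical
  let D : I ⊕ ULift.{u} ℕ → Set (StemForcing A) :=
    Sum.elim (fun i => {p | i ∈ p.2}) (fun n => {p | n.down < p.1.length})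
  have hcard : #(Set.range D) ≤ κ := by
    refine mk_range_le.trans ?_
    simpa using add_le_of_le hκ hI hκ
  obtain ⟨F, hF⟩ := hMA (StemForcing A) StemForcing.countableChainCondition (Set.range D) hcard (by
    rintro _ ⟨i | n, rfl⟩ p
    · exact ⟨(p.1, insert i p.2), Finset.mem_insert_self _ _,
        StemForcing.le_of_stem_eq rfl (Finset.subset_insert _ _)⟩
    · obtain ⟨q, hq, hn⟩ := StemForcing.exists_le_lt_length hA p n.down
      exact ⟨q, hn, hq⟩)
  have hlen : ∀ n : ℕ, ∃ p ∈ F, n < p.1.length := fun n => by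
    obtain ⟨p, hp, hn⟩ := hF _ ⟨.inr ⟨n⟩, rfl⟩
    exact ⟨p, hp, hn⟩
  choose s hs hn using hlen
  refine ⟨fun n => (s n).1[n]'(hn n), fun i => ?_⟩
  obtain ⟨p, hp, hip⟩ := hF _ ⟨.inl i, rfl⟩
  filter_upwards [Filter.eventually_ge_atTop p.1.length] with n hpn
  obtain ⟨r, -, hrp, hrs⟩ := F.directed p hp (s n) (hs n)
  refine hrp.2.2 i hip n _ hpn ?_
  obtain ⟨l, hl⟩ := hrs.1
  rw [← hl, List.getElem?_append_left (hn n), List.getElem?_eq_getElem]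

theorem MartinsAxiom.lt_continuum {κ : Cardinal.{0}} (hMA : MartinsAxiom κ) (hκ : ℵ₀ ≤ κ) :
    κ < 𝔠 := by
  by_contra! h
  -- A sequence eventually different from every sequence would be eventually different from itself.
  obtain ⟨ψ, hψ⟩ := hMA.exists_eventually hκ (I := ℕ → ℕ) (by simpa using h)
    (A := fun f n c => c ≠ f n) (fun F n => by
      obtain ⟨c, hc⟩ := Infinite.exists_notMem_finset (F.image fun f => f n)
      exact ⟨c, fun f hf h => hc (Finset.mem_image.2 ⟨f, hf, h.symm⟩)⟩)
  obtain ⟨n, hn⟩ := (hψ ψ).exists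
  exact hn rfl

/-- This is the Rasiowa–Sikorski lemma; it allows κ to be replaced by an infinite cardinal. -/
theorem martinsAxiom_aleph0 : MartinsAxiom ℵ₀ := by
  intro P _ _ _ 𝒟 h𝒟 hdense
  have : Countable 𝒟 := mk_le_aleph0_iff.1 h𝒟
  have := Encodable.ofCountable 𝒟
  let E : 𝒟 → Order.Cofinal Pᵒᵈ := fun D => ⟨OrderDual.ofDual ⁻¹' D.1, hdense D.1 D.2⟩
  refine ⟨⟨Order.idealOfCofinals (OrderDual.toDual (Classical.arbitrary P)) E⟩, fun D hD => ?_⟩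
  obtain ⟨x, hx, hx'⟩ :=
    Order.cofinal_meets_idealOfCofinals (OrderDual.toDual (Classical.arbitrary P)) E ⟨D, hD⟩
  exact ⟨OrderDual.ofDual x, hx', hx⟩

theorem MartinsAxiom.max_aleph0 {κ : Cardinal.{u}} (hMA : MartinsAxiom κ) :
    MartinsAxiom (max κ ℵ₀) := by
  rcases le_total κ ℵ₀ with h | h
  · rw [max_eq_right h]
    exact martinsAxiom_aleph0
  · rwa [max_eq_left h]

/-! ### Independent functions -/

/-- A family of at most continuum many functions on a countable set which attains all finite
patterns of values. -/
theorem exists_independent_functions {I : Type} (hI : #I ≤ 𝔠) (N : Type) [Countable N]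
    [Inhabited N] :
    ∃ (C : Type) (_ : Countable C) (y : I → C → N),
      ∀ (F : Finset I) (t : I → N), ∃ c, ∀ i ∈ F, y i c = t i := by
  classical
  obtain ⟨x⟩ : Nonempty (I ↪ (ℕ → Bool)) := by
    rw [← Cardinal.le_def]
    simpa using hI
  -- An element of `C` is a finite table on binary strings of some length `m`; `y i` looks up the
  -- first `m` bits of the real `x i`. A large `m` separates the reals indexed by `F`.
  refine ⟨Σ m : ℕ, (Fin m → Bool) → N, inferInstance, fun i c => c.2 fun k => x i k,
    fun F t => ?_⟩
  obtain ⟨m, hm⟩ : ∃ m : ℕ, ∀ i ∈ F, ∀ j ∈ F, (∀ k < m, x i k = x j k) → i = j := by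
    have key : ∀ i j, ∃ m : ℕ, (∀ k < m, x i k = x j k) → i = j := fun i j => by
      by_contra! h
      obtain ⟨k, hk⟩ := Function.ne_iff.1 (x.injective.ne (h 0).2)
      exact hk ((h (k + 1)).1 k k.lt_succ_self)
    choose b hb using key
    refine ⟨(F ×ˢ F).sup fun p => b p.1 p.2, fun i hi j hj h => hb i j fun k hk => h k ?_⟩
    exact hk.trans_le
      (Finset.le_sup (f := fun p : I × I => b p.1 p.2) (Finset.mk_mem_product hi hj))
  refine ⟨⟨m, fun s => if h : ∃ i ∈ F, ∀ k : Fin m, x i k = s k then t h.choose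
    else default⟩, fun i hi => ?_⟩
  have h : ∃ j ∈ F, ∀ k : Fin m, x j k = x i k := ⟨i, hi, fun _ => rfl⟩
  dsimp only
  rw [dif_pos h]
  congr 1
  exact hm _ h.choose_spec.1 _ hi fun k hk => h.choose_spec.2 ⟨k, hk⟩

/-! ### Generating a symmetric group from three pieces -/

namespace Equiv.Perm

/-- Two injections into a countable set `Z`, both missing infinitely many points of `Z`, differ by a
permutation supported in `Z`. -/
theorem exists_perm_comp_eq {X D : Type*} [Countable X] {Z : Set X} {a b : D → X}
    (ha : a.Injective) (hb : b.Injective) (haZ : ∀ d, a d ∈ Z) (hbZ : ∀ d, b d ∈ Z)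
    (ha' : (Z \ Set.range a).Infinite) (hb' : (Z \ Set.range b).Infinite) :
    ∃ π : Perm X, (∀ x ∉ Z, π x = x) ∧ ∀ d, π (a d) = b d := by
  classical
  have := ha'.to_subtype
  have := hb'.to_subtype
  obtain ⟨e⟩ : Nonempty (↥(Z \ Set.range a) ≃ ↥(Z \ Set.range b)) := inferInstance
  have key : ∀ c : D → X, c.Injective → (∀ d, c d ∈ Z) →
      Nonempty {f : (D ⊕ ↥(Z \ Set.range c)) ⊕ ↥(Zᶜ) ≃ X // (∀ d, f (.inl (.inl d)) = c d) ∧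
        ∀ z, f (.inr z) = z} := fun c hc hcZ => by
    refine ⟨Equiv.ofBijective (Sum.elim (Sum.elim c (↑)) (↑)) ⟨?_, fun x => ?_⟩,
      fun _ => rfl, fun _ => rfl⟩
    · refine Function.Injective.sumElim (Function.Injective.sumElim hc Subtype.val_injective ?_)
        Subtype.val_injective ?_
      · rintro d ⟨z, hz⟩ rfl
        exact hz.2 ⟨d, rfl⟩
      · rintro (d | z) w h
        · exact w.2 (h ▸ hcZ d)
        · exact w.2 (h ▸ z.2.1)
    · by_cases hx : x ∈ Z
      · by_cases hxc : x ∈ Set.range c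
        · obtain ⟨d, rfl⟩ := hxc
          exact ⟨.inl (.inl d), rfl⟩
        · exact ⟨.inl (.inr ⟨x, hx, hxc⟩), rfl⟩
      · exact ⟨.inr ⟨x, hx⟩, rfl⟩
  obtain ⟨f, hf, hf'⟩ := key a ha haZ
  obtain ⟨g, hg, hg'⟩ := key b hb hbZ
  refine ⟨f.symm.trans ((Equiv.sumCongr (Equiv.sumCongr (Equiv.refl D) e) (Equiv.refl _)).trans g),
    fun x hx => ?_, fun d => ?_⟩
  · obtain ⟨z, rfl⟩ : ∃ z : ↥(Zᶜ), f (.inr z) = x := ⟨⟨x, hx⟩, hf' _⟩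
    refine Eq.trans ?_ (hf' z).symm
    simp [hg']
  · rw [← hf d]
    simp [hg]

/-- The permutations of a countable set fixing pointwise one of the three infinite pieces of a
partition generate the symmetric group. -/
theorem eq_top_of_fixing_mem {X : Type*} [Countable X] (c : X → Fin 3)
    (hc : ∀ i, (c ⁻¹' {i}).Infinite) {K : Subgroup (Perm X)}
    (hK : ∀ i (π : Perm X), (∀ x, c x = i → π x = x) → π ∈ K) : K = ⊤ := by
  classical
  let X₀ := ↥(c ⁻¹' {0})
  -- An injection of `X₀` into two pieces, missing infinitely many points there, is undone by `K`.
  have two : ∀ (k : Fin 3) (q : X₀ → X), q.Injective → (∀ x, c (q x) ≠ k) →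
      ({x | c x ≠ k} \ Set.range q).Infinite → ∃ g ∈ K, ∀ x, g (q x) = x := by
    have into : ∀ (k l : Fin 3) (q : X₀ → X), l ≠ 0 → l ≠ k → k ≠ 0 → q.Injective →
        (∀ x, c (q x) ≠ k) → ({x | c x ≠ k} \ Set.range q).Infinite →
        ∃ g ∈ K, ∀ x, g (q x) = x := by
      intro k l q hl hlk hk hq hqk hinf
      obtain ⟨π, hπ, hπq⟩ := exists_perm_comp_eq (Z := {x | c x ≠ k}) hq
        (b := ((↑) : X₀ → X)) Subtype.val_injective hqk
        (fun x => by simpa [show c x = 0 from x.2] using hk.symm) hinf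
        ((hc l).mono fun x (hx : c x = l) => ⟨by simpa [hx] using hlk, by
          rintro ⟨y, rfl⟩; exact hl (hx.symm.trans y.2)⟩)
      exact ⟨π, hK k π fun x hx => hπ x (by simpa using hx), hπq⟩
    intro k q hq hqk hinf
    -- If `k = 0` the target `X₀` is itself the fixed piece, so the points detour through piece 1.
    rcases eq_or_ne k 0 with rfl | hk
    · have := (hc 0).to_subtype
      have := (hc 1).to_subtype
      obtain ⟨e⟩ : Nonempty (X₀ ≃ ↥(c ⁻¹' {1})) := inferInstance
      have he : ∀ x, c (e x) = 1 := fun x => (e x).2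
      obtain ⟨π, hπ, hπq⟩ := exists_perm_comp_eq (Z := {x | c x ≠ 0}) hq
        (b := fun x => (e x : X)) (Subtype.val_injective.comp e.injective) hqk
        (fun x => by simp [he]) hinf
        ((hc 2).mono fun x (hx : c x = 2) => ⟨by simp [hx], by
          rintro ⟨y, rfl⟩; simp [he] at hx⟩)
      obtain ⟨g, hg, hgx⟩ := into 2 1 (fun x => (e x : X)) (by decide) (by decide) (by decide)
        (Subtype.val_injective.comp e.injective) (fun x => by simp [he])
        ((hc 0).mono fun x (hx : c x = 0) => ⟨by simp [hx], by
          rintro ⟨y, rfl⟩; simp [he] at hx⟩)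
      exact ⟨g * π, mul_mem hg (hK 0 π fun x hx => hπ x (by simpa using hx)), fun x => by
        rw [mul_apply, hπq, hgx]⟩
    · obtain ⟨l, hl, hlk⟩ : ∃ l : Fin 3, l ≠ 0 ∧ l ≠ k := by
        clear hinf hqk; revert k; decide
      exact into k l q hl hlk hk hq hqk hinf
  refine (Subgroup.eq_top_iff' K).2 fun π₀ => ?_
  -- If `g` undoes `π₀` on `X₀`, then `g * π₀` fixes piece 0 pointwise and so lies in `K`.
  suffices h : ∃ g ∈ K, ∀ x : X₀, g (π₀ x) = x by
    obtain ⟨g, hg, hgx⟩ := h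
    have : g * π₀ ∈ K := hK 0 _ fun x hx => hgx ⟨x, hx⟩
    simpa using mul_mem (inv_mem hg) this
  have himg : ∀ j ≠ (0 : Fin 3), c ⁻¹' {j} ⊆ π₀ ⁻¹' (Set.range fun x : X₀ => π₀ x)ᶜ := by
    rintro j hj x (hx : c x = j) ⟨y, hy⟩
    obtain rfl := π₀.injective hy
    exact hj (hx.symm.trans y.2)
  -- The image of `X₀` is coinfinite because the other pieces are infinite, so some piece has room.
  obtain ⟨i, hi⟩ : ∃ i, ((c ⁻¹' {i}) \ Set.range fun x : X₀ => π₀ x).Infinite := by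
    by_contra h
    replace h : ∀ i, ((c ⁻¹' {i}) \ Set.range fun x : X₀ => π₀ x).Finite :=
      fun i => not_not.1 (not_exists.1 h i)
    have hfin : (Set.range fun x : X₀ => π₀ x)ᶜ.Finite :=
      (Set.finite_iUnion h).subset fun x hx => Set.mem_iUnion.2 ⟨c x, rfl, hx⟩
    exact hc 1 ((hfin.preimage π₀.injective.injOn).subset (himg 1 (by decide)))
  obtain ⟨j, k, hij, hik, hjk, hall⟩ : ∃ j k : Fin 3, i ≠ j ∧ i ≠ k ∧ j ≠ k ∧
      ∀ l, l = i ∨ l = j ∨ l = k := by clear hi; revert i; decide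
  -- Clear the piece `j` of the image of `X₀`, moving its points into the piece `i`.
  obtain ⟨b, hb, hbi, hbinf⟩ : ∃ b : {x : X₀ // c (π₀ x) ≠ k} → X, b.Injective ∧
      (∀ x, c (b x) = i) ∧ ((c ⁻¹' {i}) \ Set.range b).Infinite := by
    have := (hc i).to_subtype
    obtain ⟨e⟩ : Nonempty (ℕ ⊕ ℕ ≃ ↥(c ⁻¹' {i})) := inferInstance
    obtain ⟨f, hf⟩ := Countable.exists_injective_nat {x : X₀ // c (π₀ x) ≠ k}
    have hinj : Function.Injective fun n => (e (.inr n) : X) :=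
      Subtype.val_injective.comp (e.injective.comp Sum.inr_injective)
    refine ⟨fun x => e (.inl (f x)),
      Subtype.val_injective.comp (e.injective.comp (Sum.inl_injective.comp hf)),
      fun x => (e _).2, (Set.infinite_range_of_injective hinj).mono ?_⟩
    rintro _ ⟨n, rfl⟩
    refine ⟨(e _).2, ?_⟩
    rintro ⟨x, hx⟩
    simpa using e.injective (Subtype.val_injective hx)
  obtain ⟨π, hπ, hπb⟩ := exists_perm_comp_eq (Z := {x | c x ≠ k})
    (a := fun x : {x : X₀ // c (π₀ x) ≠ k} => π₀ x)
    (π₀.injective.comp (Subtype.val_injective.comp Subtype.val_injective)) hb (fun x => x.2)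
    (fun x => by simpa [hbi] using hik)
    (hi.mono fun x hx => ⟨by simpa [show c x = i from hx.1] using hik,
      fun ⟨y, hy⟩ => hx.2 ⟨y, hy⟩⟩)
    (hbinf.mono fun x hx => ⟨by simpa [show c x = i from hx.1] using hik, hx.2⟩)
  have hcases : ∀ x : X₀, (∃ y, π (π₀ x) = b y) ∨ (c (π₀ x) = k ∧ π (π₀ x) = π₀ x) := fun x => by
    by_cases hx : c (π₀ x) = k
    · exact .inr ⟨hx, hπ _ (by simpa using hx)⟩
    · exact .inl ⟨⟨x, hx⟩, hπb ⟨x, hx⟩⟩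
  obtain ⟨g, hg, hgx⟩ := two j (fun x => π (π₀ x))
    (π.injective.comp (π₀.injective.comp Subtype.val_injective))
    (fun x => by
      rcases hcases x with ⟨y, hy⟩ | ⟨hx, hy⟩
      · simpa [hy, hbi] using hij
      · simpa [hy, hx] using hjk.symm)
    (hbinf.mono fun x hx => ⟨by simpa [show c x = i from hx.1] using hij, by
      rintro ⟨y, rfl⟩
      rcases hcases y with ⟨z, hz⟩ | ⟨hy, hz⟩
      · exact hx.2 ⟨z, hz.symm⟩
      · exact hik (by simpa [hz, hy] using hx.1.symm)⟩)
  exact ⟨g * π, mul_mem hg (hK k π fun x hx => hπ x (by simpa using hx)), hgx⟩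

end Equiv.Perm

/-! ### From inducing all permutations of a subset to the full group -/

namespace Equiv.Perm

theorem exists_perm_of_fixing_compl_range {J X : Type*} (ι : J ↪ X) (π : Perm X)
    (hπ : ∀ x ∉ Set.range ι, π x = x) : ∃ k : Perm J, ∀ j, π (ι j) = ι (k j) := by
  have key : ∀ j, π (ι j) ∈ Set.range ι := fun j => by
    by_contra h
    exact h ⟨j, (π.injective (hπ _ h)).symm⟩
  choose k hk using key
  refine ⟨Equiv.ofBijective k ⟨fun i j hij => ?_, fun j => ?_⟩, fun j => (hk j).symm⟩
  · exact ι.injective (π.injective (by rw [← hk, ← hk, hij]))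
  · obtain ⟨x, hx⟩ := π.surjective (ι j)
    have : x ∈ Set.range ι := by
      by_contra h
      rw [hπ x h] at hx
      exact h ⟨j, hx.symm⟩
    obtain ⟨i, rfl⟩ := this
    exact ⟨i, ι.injective ((hk i).trans hx)⟩

/-- The symmetric group of an infinite, coinfinite subset generates the whole symmetric group
together with finitely many permutations. -/
theorem exists_finite_eq_top_of_supported_mem {X : Type*} [Countable X] {M : Set X}
    (hM : M.Infinite) (hM' : Mᶜ.Infinite) :
    ∃ F : Set (Perm X), F.Finite ∧ ∀ K : Subgroup (Perm X), F ⊆ K →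
      (∀ π : Perm X, (∀ x ∉ M, π x = x) → π ∈ K) → K = ⊤ := by
  classical
  have := hM.to_subtype
  have := hM'.to_subtype
  obtain ⟨a⟩ : Nonempty (M ≃ ℕ ⊕ ℕ) := inferInstance
  obtain ⟨b⟩ : Nonempty (↥Mᶜ ≃ ℕ) := inferInstance
  let e : X ≃ (ℕ ⊕ ℕ) ⊕ ℕ := (Equiv.Set.sumCompl M).symm.trans (Equiv.sumCongr a b)
  have he : ∀ x, x ∉ M → ∃ n, e x = .inr n := fun x hx =>
    ⟨b ⟨x, hx⟩, by simp [e, Equiv.Set.sumCompl_symm_apply_of_notMem hx]⟩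
  -- Piece 0 is the complement of `M`, which is itself split into pieces 1 and 2. Rotating the
  -- pieces conjugates a permutation fixing any one piece to one supported in `M`.
  let r : Perm ((ℕ ⊕ ℕ) ⊕ ℕ) :=
    (Equiv.sumAssoc ℕ ℕ ℕ).trans (Equiv.sumComm ℕ (ℕ ⊕ ℕ))
  let c : (ℕ ⊕ ℕ) ⊕ ℕ → Fin 3 := Sum.elim (Sum.elim (fun _ => 2) (fun _ => 1)) (fun _ => 0)
  have hr : ∀ x, c (r x) = c x + 1 := by rintro ((n | n) | n) <;> rfl
  let ρ : Perm X := e.symm.permCongr r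
  have hρ : ∀ x, c (e (ρ x)) = c (e x) + 1 := fun x => by
    simp [ρ, Equiv.permCongr_apply, hr]
  refine ⟨{ρ}, Set.finite_singleton _, fun K hF hK => ?_⟩
  have hρK : ρ ∈ K := hF rfl
  have hrot : ∀ i, ∃ τ ∈ K, ∀ x, c (e (τ x)) = c (e x) + i := fun i => by
    fin_cases i
    · exact ⟨1, one_mem K, fun x => by simp⟩
    · exact ⟨ρ, hρK, hρ⟩
    · exact ⟨ρ * ρ, mul_mem hρK hρK, fun x => by rw [mul_apply, hρ, hρ, add_assoc]; rfl⟩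
  refine eq_top_of_fixing_mem (fun x => c (e x)) (fun i => ?_) fun i π hπ => ?_
  · have key : ∀ f : ℕ → (ℕ ⊕ ℕ) ⊕ ℕ, f.Injective → (∀ n, c (f n) = i) →
        ((fun x => c (e x)) ⁻¹' {i}).Infinite := fun f hf hfi =>
      (Set.infinite_range_of_injective (e.symm.injective.comp hf)).mono (by
        rintro _ ⟨n, rfl⟩
        simp [hfi])
    fin_cases i
    · exact key _ Sum.inr_injective fun _ => rfl
    · exact key _ (Sum.inl_injective.comp Sum.inr_injective) fun _ => rfl
    · exact key _ (Sum.inl_injective.comp Sum.inl_injective) fun _ => rfl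
  · obtain ⟨τ, hτ, hτc⟩ := hrot i
    have hm : τ⁻¹ * π * τ ∈ K := hK _ fun x hx => by
      obtain ⟨n, hn⟩ := he x hx
      have hi : c (e (τ x)) = i := by rw [hτc, hn]; exact zero_add i
      simp [hπ _ hi]
    simpa [mul_assoc] using mul_mem (mul_mem hτ hm) (inv_mem hτ)

/-- Elements of `K` are only required to act in a prescribed way on the range of `ρ`; commuting
them with the shift of `J × ℤ` removes what they do elsewhere. -/
theorem mem_of_forall_exists_agree {J X : Type*} (ρ : J × ℤ ↪ X) {K : Subgroup (Perm X)}
    {u : Perm X} (huK : u ∈ K) (hu : ∀ j m, u (ρ (j, m)) = ρ (j, m + 1))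
    (hu' : ∀ x ∉ Set.range ρ, u x = x)
    (hK : ∀ h : Perm (J × ℤ), ∃ W ∈ K, ∀ p, W (ρ p) = ρ (h p)) {π : Perm X}
    (hπ : ∀ x ∉ Set.range fun j => ρ (j, 0), π x = x) : π ∈ K := by
  classical
  let ι : J ↪ X := ⟨fun j => ρ (j, 0), fun i j h => (Prod.ext_iff.1 (ρ.injective h)).1⟩
  obtain ⟨k, hk⟩ := exists_perm_of_fixing_compl_range ι π hπ
  replace hk : ∀ j, π (ρ (j, 0)) = ρ (k j, 0) := hk
  -- `h` applies `k` on all levels `m ≥ 0`. In its commutator with the shift, the copies of `k`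
  -- cancel on every level but 0. Off the range of `ρ` the shift is trivial, so `W` cancels with its
  -- inverse.
  let h : Perm (J × ℤ) :=
    { toFun := fun p => (if 0 ≤ p.2 then k p.1 else p.1, p.2)
      invFun := fun p => (if 0 ≤ p.2 then k.symm p.1 else p.1, p.2)
      left_inv := by rintro ⟨j, m⟩; by_cases hm : 0 ≤ m <;> simp [hm]
      right_inv := by rintro ⟨j, m⟩; by_cases hm : 0 ≤ m <;> simp [hm] }
  obtain ⟨W, hW, hWh⟩ := hK h
  suffices π = W * u * W⁻¹ * u⁻¹ by
    rw [this]
    exact mul_mem (mul_mem (mul_mem hW huK) (inv_mem hW)) (inv_mem huK)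
  rw [eq_mul_inv_iff_mul_eq, eq_mul_inv_iff_mul_eq]
  ext x
  simp only [mul_apply]
  by_cases hx : x ∈ Set.range ρ
  · obtain ⟨⟨j, m⟩, rfl⟩ := hx
    rw [hWh, hu]
    rcases lt_trichotomy (m + 1) 0 with hm | hm | hm
    · have h0 : ¬ 0 ≤ m := by omega
      have h1 : ¬ 0 ≤ m + 1 := by omega
      simp only [h, Equiv.coe_fn_mk, h0, if_false]
      rw [hu, hWh, hπ]
      · simp [h, h1]
      · rintro ⟨i, hi⟩
        have := congrArg Prod.snd (ρ.injective hi)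
        simp at this
        omega
    · have h0 : ¬ 0 ≤ m := by omega
      simp only [h, Equiv.coe_fn_mk, h0, if_false]
      rw [hu, hWh, hm, hk]
      simp [h]
    · have h0 : 0 ≤ m := by omega
      have h1 : 0 ≤ m + 1 := by omega
      simp only [h, Equiv.coe_fn_mk, h0, if_true]
      rw [hu, hWh, hπ]
      · simp [h, h1]
      · rintro ⟨i, hi⟩
        have := congrArg Prod.snd (ρ.injective hi)
        simp at this
        omega
  · have hWx : W x ∉ Set.range ρ := by
      rintro ⟨p, hp⟩
      obtain ⟨q, rfl⟩ := h.surjective p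
      rw [← hWh] at hp
      exact hx ⟨q, W.injective hp⟩
    rw [hu' _ hx, hu' _ hWx, hπ]
    rintro ⟨j, hj⟩
    exact hWx ⟨_, hj⟩

/-- If a subgroup of the symmetric group of a countable set contains suitable finitely many
elements, and induces every permutation of some infinite subset, then it is everything. -/
theorem exists_finite_eq_top_of_induces {N X : Type*} [Countable N] [Infinite N] [Countable X]
    (ι : N ↪ X) :
    ∃ F : Set (Perm X), F.Finite ∧ ∀ K : Subgroup (Perm X), F ⊆ K →
      (∀ h : Perm N, ∃ W ∈ K, ∀ n, W (ι n) = ι (h n)) → K = ⊤ := by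
  classical
  obtain ⟨e⟩ : Nonempty (ℕ × ℤ ≃ N) := inferInstance
  let ρ : ℕ × ℤ ↪ X := e.toEmbedding.trans ι
  let u : Perm X := viaEmbedding (Equiv.prodCongr (Equiv.refl ℕ) (Equiv.addRight (1 : ℤ))) ρ
  have hinj : ∀ m : ℤ, Function.Injective fun j => ρ (j, m) := fun m i j h =>
    (Prod.ext_iff.1 (ρ.injective h)).1
  obtain ⟨F, hF, hFK⟩ := exists_finite_eq_top_of_supported_mem
    (M := Set.range fun j => ρ (j, 0)) (Set.infinite_range_of_injective (hinj 0))
    ((Set.infinite_range_of_injective (hinj 1)).mono (by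
      rintro _ ⟨j, rfl⟩ ⟨i, hi⟩
      simpa using congrArg Prod.snd (ρ.injective hi)))
  refine ⟨insert u F, hF.insert u, fun K hK hind => hFK K ((Set.subset_insert _ _).trans hK)
    fun π hπ => mem_of_forall_exists_agree ρ (hK (Set.mem_insert _ _))
      (fun j m => ?_) (fun x hx => viaEmbedding_apply_of_notMem _ _ _ hx) (fun h => ?_) hπ⟩
  · exact viaEmbedding_apply _ ρ (j, m)
  · obtain ⟨W, hW, hWh⟩ := hind (e.permCongr h)
    exact ⟨W, hW, fun p => (hWh (e p)).trans (by simp [ρ])⟩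

end Equiv.Perm

/-! ### Computing with registers -/

namespace Registers

open Equiv.Perm

/-- Memory states: two integer registers, and between them one for an element of `C`. -/
abbrev State (C : Type*) := ℤ × C × ℤ

variable {C : Type*}

/-- Add a function of the first two registers to the third one. -/
def shear (d : ℤ → C → ℤ) : Equiv.Perm (State C) where
  toFun p := (p.1, p.2.1, p.2.2 + d p.1 p.2.1)
  invFun p := (p.1, p.2.1, p.2.2 - d p.1 p.2.1)
  left_inv p := by simp
  right_inv p := by simp

/-- Translate the first register. -/
def translate (m : ℤ) : Equiv.Perm (State C) :=
  Equiv.prodCongr (Equiv.addRight m) (Equiv.refl _)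

/-- Exchange the first and the third register. -/
def exchange : Equiv.Perm (State C) where
  toFun p := (p.2.2, p.2.1, p.1)
  invFun p := (p.2.2, p.2.1, p.1)
  left_inv _ := rfl
  right_inv _ := rfl

/-- Interchange `c₀` and `ψ n` in the second register, where `n` is the content of the first. -/
def load [DecidableEq C] (c₀ : C) (ψ : ℤ → C) : Equiv.Perm (State C) where
  toFun p := (p.1, Equiv.swap c₀ (ψ p.1) p.2.1, p.2.2)
  invFun p := (p.1, Equiv.swap c₀ (ψ p.1) p.2.1, p.2.2)
  left_inv p := by simp
  right_inv p := by simp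

theorem shear_add (d d' : ℤ → C → ℤ) :
    shear (fun n c => d n c + d' n c) = shear d * shear d' := by
  ext p <;> simp [shear]
  ring

theorem shear_neg (d : ℤ → C → ℤ) : shear (fun n c => -d n c) = (shear d)⁻¹ := by
  rw [eq_inv_iff_mul_eq_one, ← shear_add]
  ext p <;> simp [shear]

theorem translate_add (m m' : ℤ) : (translate (m + m') : Equiv.Perm (State C)) =
    translate m * translate m' := by
  ext p <;> simp [translate]
  ring

theorem translate_neg (m : ℤ) : (translate (-m) : Equiv.Perm (State C)) = (translate m)⁻¹ := by
  rw [eq_inv_iff_mul_eq_one, ← translate_add]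
  ext p <;> simp [translate]

theorem translate_mem {K : Subgroup (Equiv.Perm (State C))} (h : translate 1 ∈ K) (m : ℤ) :
    translate m ∈ K := by
  let L : AddSubgroup ℤ :=
    { carrier := {m | translate m ∈ K}
      zero_mem' := by
        have : (translate 0 : Equiv.Perm (State C)) = 1 := by ext p <;> simp [translate]
        simp [this]
      add_mem' := fun {a b} ha hb => by
        simpa [translate_add] using mul_mem (S := Subgroup _) ha hb
      neg_mem' := fun {a} ha => by simpa [translate_neg] using ha }
  have hm : m • (1 : ℤ) ∈ L := zsmul_mem (show (1 : ℤ) ∈ L from h) m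
  rwa [smul_eq_mul, mul_one] at hm

/-- Conjugating the unit shear at 0 by translations gives the unit shear at any `m`, and these
generate. This supplies the finite corrections. -/
theorem shear_mem_of_finite_support {K : Subgroup (Equiv.Perm (State C))} (h : translate 1 ∈ K)
    (h' : shear (fun n _ => Pi.single (M := fun _ => ℤ) (0 : ℤ) (1 : ℤ) n) ∈ K) {d : ℤ → ℤ}
    (hd : d.support.Finite) : shear (fun n _ => d n) ∈ K := by
  let L : AddSubgroup (ℤ → ℤ) :=
    { carrier := {d | shear (fun n _ => d n) ∈ K}
      zero_mem' := by
        have : (shear (fun _ _ => 0) : Equiv.Perm (State C)) = 1 := by ext p <;> simp [shear]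
        simp [this]
      add_mem' := fun {a b} ha hb => by
        simpa [shear_add] using mul_mem (S := Subgroup _) ha hb
      neg_mem' := fun {a} ha => by simpa [shear_neg] using ha }
  have hsingle : ∀ m : ℤ, (Pi.single m 1 : ℤ → ℤ) ∈ L := fun m => by
    have : (shear (fun n _ => (Pi.single m 1 : ℤ → ℤ) n) : Equiv.Perm (State C)) =
        translate m * shear (fun n _ => Pi.single (M := fun _ => ℤ) (0 : ℤ) (1 : ℤ) n) *
          translate (-m) := by
      ext p <;> simp [shear, translate, Pi.single_apply, add_neg_eq_zero]
    change shear _ ∈ K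
    rw [this]
    exact mul_mem (mul_mem (translate_mem h m) h') (translate_mem h _)
  have hsum : d = ∑ m ∈ hd.toFinset, d m • (Pi.single m 1 : ℤ → ℤ) := by
    ext n
    simp +contextual [Finset.sum_apply, Pi.single_apply]
  change d ∈ L
  rw [hsum]
  exact sum_mem fun m _ => zsmul_mem (hsingle m) _

/-- If `y ∘ ψ` agrees with `t` up to finitely many places, then loading `ψ` and adding `y` computes
`t`, up to a correction by a fixed finite set of permutations. -/
theorem exists_mem_computes [DecidableEq C] {K : Subgroup (Equiv.Perm (State C))}
    (h : translate 1 ∈ K)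
    (h' : shear (fun n _ => Pi.single (M := fun _ => ℤ) (0 : ℤ) (1 : ℤ) n) ∈ K)
    {y : C → ℤ} (hy : shear (fun _ c => y c) ∈ K) {c₀ : C} {ψ : ℤ → C} (hψ : load c₀ ψ ∈ K)
    {t : ℤ → ℤ} (ht : {n | y (ψ n) ≠ t n}.Finite) :
    ∃ W ∈ K, ∀ n, W (n, c₀, 0) = (n, c₀, t n) := by
  -- Read from the right: load `ψ n`, add `y (ψ n)`, unload, then correct at the finitely many bad
  -- `n`.
  refine ⟨shear (fun n _ => t n - y (ψ n)) * (load c₀ ψ)⁻¹ * shear (fun _ c => y c) * load c₀ ψ,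
    mul_mem (mul_mem (mul_mem (shear_mem_of_finite_support h h' (ht.subset fun n hn hy => ?_))
      (inv_mem hψ)) hy) hψ, fun n => ?_⟩
  · exact hn (by simp [hy])
  · have hinv : (load c₀ ψ)⁻¹ (n, ψ n, y (ψ n)) = (n, c₀, y (ψ n)) := by
      rw [inv_eq_iff_eq]
      simp [load]
    have h₁ : load c₀ ψ (n, c₀, 0) = (n, ψ n, 0) := by simp [load]
    have h₂ : shear (fun _ c => y c) (n, ψ n, 0) = (n, ψ n, y (ψ n)) := by simp [shear]
    rw [mul_apply, mul_apply, mul_apply, h₁, h₂, hinv]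
    simp [shear]

/-- Reversible computation of a permutation `h` of `ℤ`: compute `h n` beside `n`, exchange the two,
then erase `n` by undoing the computation of `h.symm` at `h n`. -/
theorem exists_finite_eq_top_of_computes [Countable C] (c₀ : C) :
    ∃ F : Set (Equiv.Perm (State C)), F.Finite ∧ ∀ K : Subgroup (Equiv.Perm (State C)), F ⊆ K →
      (∀ t : ℤ → ℤ, ∃ W ∈ K, ∀ n, W (n, c₀, 0) = (n, c₀, t n)) → K = ⊤ := by
  obtain ⟨F, hF, hFK⟩ := exists_finite_eq_top_of_induces
    (⟨fun n => (n, c₀, 0), fun m n h => (Prod.ext_iff.1 h).1⟩ : ℤ ↪ State C)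
  refine ⟨insert exchange F, hF.insert _, fun K hK hcomp =>
    hFK K ((Set.subset_insert _ _).trans hK) fun h => ?_⟩
  obtain ⟨W₁, hW₁, hW₁h⟩ := hcomp h
  obtain ⟨W₂, hW₂, hW₂h⟩ := hcomp h.symm
  refine ⟨W₂⁻¹ * exchange * W₁,
    mul_mem (mul_mem (inv_mem hW₂) (hK (Set.mem_insert _ _))) hW₁, fun n => ?_⟩
  change W₂⁻¹ (exchange (W₁ (n, c₀, 0))) = (h n, c₀, 0)
  rw [hW₁h, inv_eq_iff_eq, hW₂h]
  simp [exchange]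

end Registers

/-! ### The permutation avoiding all the subgroups -/

/-- Under `MA_κ`, a family of at most `κ` proper subgroups of `Sym(ω)` does not cover `Sym(ω)`,
provided each of them contains certain finitely many permutations. -/
theorem MartinsAxiom.exists_forall_notMem {κ : Cardinal.{0}} (hMA : MartinsAxiom κ) {I : Type}
    (hI : #I ≤ κ) :
    ∃ (f : I → Equiv.Perm ℕ) (F : Set (Equiv.Perm ℕ)), F.Finite ∧
      ∀ K : I → Subgroup (Equiv.Perm ℕ), (∀ i, K i ≠ ⊤) → (∀ i, F ⊆ K i) → (∀ i, f i ∈ K i) →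
        ∃ g, ∀ i, g ∉ K i := by
  classical
  replace hMA := hMA.max_aleph0
  replace hI : #I ≤ max κ ℵ₀ := hI.trans (le_max_left _ _)
  obtain ⟨C, _, y, hy⟩ := exists_independent_functions
    (hI.trans (hMA.lt_continuum (le_max_right _ _)).le) ℤ
  have c₀ : C := (hy ∅ fun _ => 0).choose
  obtain ⟨F, hF, hFK⟩ := Registers.exists_finite_eq_top_of_computes c₀
  obtain ⟨e⟩ : Nonempty (Registers.State C ≃ ℕ) := by
    have : Nonempty C := ⟨c₀⟩
    infer_instance
  obtain ⟨z⟩ : Nonempty (ℤ ≃ ℕ) := inferInstance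
  let Φ : Equiv.Perm (Registers.State C) ≃* Equiv.Perm ℕ := e.permCongrHom
  let s : Equiv.Perm (Registers.State C) :=
    Registers.shear fun n _ => Pi.single (M := fun _ => ℤ) (0 : ℤ) (1 : ℤ) n
  refine ⟨fun i => Φ (Registers.shear fun _ c => y i c),
    Φ '' insert (Registers.translate 1) (insert s F), ((hF.insert _).insert _).image _,
    fun K hK hFK' hf => ?_⟩
  let L : I → Subgroup (Equiv.Perm (Registers.State C)) := fun i => (K i).comap Φ.toMonoidHom
  have hL : ∀ i, insert (Registers.translate 1) (insert s F) ⊆ (L i : Set _) := fun i x hx =>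
    hFK' i ⟨x, hx, rfl⟩
  have hLtop : ∀ i, ∃ t : ℤ → ℤ, ¬ ∃ W ∈ L i, ∀ n, W (n, c₀, 0) = (n, c₀, t n) := fun i => by
    by_contra! h
    have := hFK (L i) (fun x hx => hL i (.inr (.inr hx))) h
    refine hK i ((Subgroup.eq_top_iff' _).2 fun g => ?_)
    have hg : Φ.symm g ∈ L i := this ▸ Subgroup.mem_top _
    simpa [L] using hg
  choose t ht using hLtop
  obtain ⟨ψ, hψ⟩ := hMA.exists_eventually (le_max_right _ _) hI
    (A := fun i n c => y i c = t i (z.symm n)) fun G n => hy G fun i => t i (z.symm n)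
  refine ⟨Φ (Registers.load c₀ (ψ ∘ z)), fun i hi => ht i ?_⟩
  refine Registers.exists_mem_computes (y := y i) (hL i (.inl rfl)) (hL i (.inr (.inl rfl))) (hf i)
    (show Registers.load c₀ (ψ ∘ z) ∈ L i from hi) ?_
  have := hψ i
  rw [← Nat.cofinite_eq_atTop, Filter.eventually_cofinite] at this
  refine (this.preimage z.injective.injOn).subset fun n hn => ?_
  simpa using hn

/-! ### Chains and the cofinality spectrum -/

namespace IsProperSubgroupChain

variable {G : Type u} [Group G] {I : Type v} [LinearOrder I] {H : I → Subgroup G}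

theorem exists_mem (hH : IsProperSubgroupChain H) (g : G) : ∃ i, g ∈ H i := by
  have : g ∈ ⋃ i, (H i : Set G) := hH.iUnion_eq ▸ Set.mem_univ g
  simpa using this

theorem exists_ge_finite_subset (hH : IsProperSubgroupChain H) (i : I) {F : Set G}
    (hF : F.Finite) : ∃ j, i ≤ j ∧ F ⊆ H j := by
  induction F, hF using Set.Finite.induction_on with
  | empty => exact ⟨i, le_rfl, Set.empty_subset _⟩
  | @insert g F _ _ ih =>
    obtain ⟨j, hij, hj⟩ := ih
    obtain ⟨k, hk⟩ := hH.exists_mem g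
    exact ⟨max j k, hij.trans (le_max_left _ _), Set.insert_subset (hH.mono (le_max_right _ _) hk)
      (hj.trans (hH.mono (le_max_left _ _)))⟩

theorem noMaxOrder (hH : IsProperSubgroupChain H) : NoMaxOrder I where
  exists_gt i := by
    by_contra! h
    refine hH.proper i ((Subgroup.eq_top_iff' _).2 fun g => ?_)
    obtain ⟨j, hj⟩ := hH.exists_mem g
    exact hH.mono (h j) hj

theorem nonempty (hH : IsProperSubgroupChain H) : Nonempty I :=
  ⟨(hH.exists_mem 1).choose⟩

theorem comp {J : Type*} [LinearOrder J] (hH : IsProperSubgroupChain H) {f : J → I}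
    (hf : Monotone f) (hf' : IsCofinal (Set.range f)) : IsProperSubgroupChain (H ∘ f) where
  mono := hH.mono.comp hf
  proper j := hH.proper _
  iUnion_eq := by
    refine Set.eq_univ_of_forall fun g => ?_
    obtain ⟨i, hi⟩ := hH.exists_mem g
    obtain ⟨_, ⟨j, rfl⟩, hj⟩ := hf' i
    exact Set.mem_iUnion.2 ⟨j, hH.mono hj hi⟩

/-- A chain of subgroups along a well-order yields an element of the cofinality spectrum. -/
theorem cof_mem_cofinalitySpectrum {I : Type u} [LinearOrder I] [WellFoundedLT I]
    {H : I → Subgroup G} (hH : IsProperSubgroupChain H) :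
    Order.cof I ∈ cofinalitySpectrum G := by
  have := hH.noMaxOrder
  have := hH.nonempty
  obtain ⟨s, hs, hs'⟩ := Ordinal.exists_ord_cof_eq I
  refine ⟨⟨Order.aleph0_le_cof, (Order.cof_ord_cof I).ge⟩, ?_⟩
  obtain ⟨e⟩ : Nonempty ((Order.cof I).ord.ToType ≃o s) := by
    obtain ⟨r⟩ := Ordinal.type_eq.1 ((Ordinal.type_toType _).trans hs'.symm)
    exact ⟨OrderIso.ofRelIsoLT r⟩
  exact ⟨_, hH.comp (f := fun j => (e j : I)) (fun i j h => e.monotone h) fun i => by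
    obtain ⟨j, hj, hij⟩ := hs i
    exact ⟨j, ⟨e.symm ⟨j, hj⟩, by simp⟩, hij⟩⟩

end IsProperSubgroupChain

theorem Subgroup.mk_closure_le {G : Type u} [Group G] (s : Set G) :
    #(Subgroup.closure s) ≤ max #s ℵ₀ := by
  rcases s.eq_empty_or_nonempty with rfl | hs
  · rw [Subgroup.closure_empty]
    exact mk_le_aleph0.trans (le_max_right _ _)
  · have := hs.to_subtype
    rw [FreeGroup.closure_eq_range, ← mk_freeGroup s]
    exact mk_range_le

/-- Enumerate `G` in order type `(#G).ord`: each proper initial segment generates a subgroup of size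
less than `#G`. Hence the infimum defining the cofinality is attained. -/
theorem cofinalitySpectrum_nonempty (G : Type u) [Group G] [Uncountable G] :
    (cofinalitySpectrum G).Nonempty := by
  have hG : ℵ₀ < #G := aleph0_lt_mk
  obtain ⟨e⟩ : Nonempty ((#G).ord.ToType ≃ G) := Cardinal.eq.1 (mk_ord_toType _)
  have hchain : IsProperSubgroupChain fun i : (#G).ord.ToType =>
      Subgroup.closure (e '' Set.Iio i) := by
    refine ⟨fun i j hij => Subgroup.closure_mono (Set.image_mono (Set.Iio_subset_Iio hij)),
      fun i h => ?_, Set.eq_univ_of_forall fun g => ?_⟩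
    · have hlt : #(Subgroup.closure (e '' Set.Iio i)) < #G :=
        (Subgroup.mk_closure_le _).trans_lt
          (max_lt (mk_image_le.trans_lt (by simpa using mk_Iio_lt i)) hG)
      rw [h, Cardinal.mk_congr Subgroup.topEquiv.toEquiv] at hlt
      exact hlt.false
    · have := Cardinal.noMaxOrder hG.le
      obtain ⟨i, hi⟩ := exists_gt (e.symm g)
      exact Set.mem_iUnion.2 ⟨i, Subgroup.subset_closure ⟨_, hi, by simp⟩⟩
  exact ⟨_, hchain.cof_mem_cofinalitySpectrum⟩

theorem MartinsAxiom.iUnion_ne_univ {κ : Cardinal.{0}} (hMA : MartinsAxiom κ) {I : Type}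
    (hI : #I ≤ κ) {J : I → Type} [∀ i, LinearOrder (J i)]
    {H : (i : I) → J i → Subgroup (Equiv.Perm ℕ)} (hH : ∀ i, IsProperSubgroupChain (H i))
    (f : (i : I) → J i) : ⋃ i, (H i (f i) : Set (Equiv.Perm ℕ)) ≠ Set.univ := by
  obtain ⟨p, F, hF, hFK⟩ := hMA.exists_forall_notMem hI
  -- Raising the indices only enlarges the subgroups, and they stay proper.
  choose j hfj hj using fun i => (hH i).exists_ge_finite_subset (f i) (hF.insert (p i))
  obtain ⟨g, hg⟩ := hFK (fun i => H i (j i)) (fun i => (hH i).proper _)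
    (fun i => (Set.subset_insert _ _).trans (hj i)) (fun i => hj i (Set.mem_insert _ _))
  intro h
  obtain ⟨i, hi⟩ := Set.mem_iUnion.1 (h ▸ Set.mem_univ g : g ∈ ⋃ i, (H i (f i) : Set _))
  exact hg i ((hH i).mono (hfj i) hi)

theorem theorem2p3 (κ : Cardinal.{0}) (hMA : MartinsAxiom κ) :
    (∀ (θ : κ.ord.ToType → Ordinal.{0})
        (H : (α : κ.ord.ToType) → (θ α).ToType → Subgroup (Equiv.Perm ℕ)),
        (∀ α, IsProperSubgroupChain (H α)) →
        ∀ f : (α : κ.ord.ToType) → (θ α).ToType,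
          ⋃ α, (H α (f α) : Set (Equiv.Perm ℕ)) ≠ Set.univ) ∧
      κ < groupCofinality (Equiv.Perm ℕ) := by
  refine ⟨fun θ H hH f => hMA.iUnion_ne_univ (mk_ord_toType κ).le hH f, ?_⟩
  have : Uncountable (Equiv.Perm ℕ) := by
    rw [← aleph0_lt_mk_iff, mk_perm_eq_two_power, mk_nat]
    exact cantor _
  obtain ⟨-, H, hH⟩ := csInf_mem (cofinalitySpectrum_nonempty (Equiv.Perm ℕ))
  change (groupCofinality (Equiv.Perm ℕ)).ord.ToType → _ at H
  by_contra! h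
  -- The constant family of chains with `f = id` has as its union the whole chain.
  refine hMA.iUnion_ne_univ ((mk_ord_toType _).le.trans h) (fun _ => hH) id hH.iUnion_eq
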